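/- Let $X$ be a CAT(0) cube complex, that is, a simply connected (in particular non-empty and connected) cube complex in which the link of every vertex is a flag simplicial complex; $X$ is not assumed to be finite-dimensional or locally finite. Let $d$ be the combinatorial metric on the vertices of $X$ (the minimal length of an edge path). A half-space $H$ of $X$ is one of the two components of the complement of a hyperplane, regarded as a set of vertices; $\overline H$ denotes the complementary half-space. Let $g$ be an automorphism of $X$ that acts without inversion ($gH\neq\overline H$ for every half-space $H$), and let $\ell_g=\min_x d(x,gx)$ over the vertices $x$ of $X$ be its combinatorial translation length. Suppose that $g$ is hyperbolic, i.e. $\ell_g>0$. A combinatorial axis of $g$ is a bi-infinite combinatorial geodesic $(\gamma_i)_{i\in\mathbb Z}$ of vertices with $g\gamma_i=\gamma_{i+\ell_g}$ for all $i$. Let $\mathcal A_g^+$ be the set of half-spaces $H$ with $\gamma_i\notin H$, $\gamma_{i+1}\in H$ for some combinatorial axis $\gamma$ of $g$ and some $i$, and let $\mathcal A_g=\mathcal A_g^+\cup\{\overline H: H\in\mathcal A_g^+\}$. Let $X(\mathcal A_g)$ be the cube complex given by the Sageev construction on $\mathcal A_g$: its vertices are the ultrafilters on $\mathcal A_g$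 (sets containing exactly one of $H,\overline H$ for each $H\in\mathcal A_g$, no two elements being disjoint) that differ in finitely many elements from $\pi(v)=\{H\in\mathcal A_g: v\in H\}$ for some vertex $v$ of $X$; two vertices are adjacent if they differ on exactly one pair $\{H,\overline H\}$; and a cube is added whenever its $1$-skeleton is present. Let $M_g$ be the full subcomplex of $X$ generated by the vertices $x$ with $d(x,gx)=\ell_g$. The essential minimal set $\mathfrak M_g$ of $g$ is the projection of $M_g$ to $X(\mathcal A_g)$ under $\pi$, i.e. the subcomplex consisting of the images of the cubes of $M_g$. Then $\mathfrak M_g$ is finite-dimensional, and $\dim \mathfrak M_g\le \ell_g$. -/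

import Mathlib

/-- The isometric inclusions `[0,1]^m → [0,1]^n` of a cube as a face of another cube, recorded on
vertices: a map `{0,1}^m → {0,1}^n` extends to such an inclusion if and only if it preserves the
Hamming distance.  For `m = n` these are the symmetries of the cube. -/
@[ext]
structure FaceMap (m n : ℕ) where
  toFun : (Fin m → Bool) → (Fin n → Bool)
  isometry' : ∀ x y, hammingDist (toFun x) (toFun y) = hammingDist x y

namespace FaceMap

/-- The identity of a cube. -/
def id (n : ℕ) : FaceMap n n := ⟨fun x => x, fun _ _ => rfl⟩

/-- Composition of face maps. -/
def comp {k m n : ℕ} (f : FaceMap m n) (f' : FaceMap k m) : FaceMap k n :=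
  ⟨fun x => f.toFun (f'.toFun x), fun x y => by rw [f.isometry', f'.isometry']⟩

/-- The vertex `t` of the `n`-cube. -/
def vertex {n : ℕ} (t : Fin n → Bool) : FaceMap 0 n :=
  ⟨fun _ => t, fun x y => by rw [Subsingleton.elim x y]; simp⟩

/-- The edge of the `n`-cube through the vertex `t` in direction `i`, oriented so that the `i`-th
coordinate increases. -/
def edge {n : ℕ} (t : Fin n → Bool) (i : Fin n) : FaceMap 1 n :=
  ⟨fun x => Function.update t i (x 0), fun x y => by
    by_cases h : x 0 = y 0
    · have hxy : x = y := by
        funext j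
        rw [Subsingleton.elim j 0]
        exact h
      rw [hxy]
      simp
    · have h1 : hammingDist x y = 1 := by
        rw [hammingDist, Finset.card_eq_one]
        refine ⟨0, ?_⟩
        ext j
        rw [Subsingleton.elim j 0]
        simp [h]
      rw [h1, hammingDist, Finset.card_eq_one]
      refine ⟨i, ?_⟩
      ext j
      by_cases hj : j = i
      · subst hj
        simp [h]
      · simp [hj]⟩

/-- The reflection of the `1`-cube. -/
def flip : FaceMap 1 1 :=
  ⟨fun x j => !(x j), fun x y => by simp [hammingDist]⟩

end FaceMap

/-- A cube complex: a collection of cubes glued along isometries of their faces.  `Cube n` is the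
set of *parametrized* `n`-cubes (characteristic maps of the `n`-cells, so that an `n`-cell appears
once for each of its parametrizations by `[0,1]^n`), and `face f c` is the restriction of the
parametrized cube `c` to a face of `[0,1]^n`, or the reparametrization of `c` when `f` is a
symmetry.  The last axiom says that no cube is folded onto itself.  Cubes need not be embedded and
may have any intersection; the dimension is not assumed to be bounded, and no local finiteness is
assumed. -/
structure CubeComplex where
  Cube : ℕ → Type*
  face : ∀ {m n : ℕ}, FaceMap m n → Cube n → Cube m
  face_id : ∀ {n : ℕ} (c : Cube n), face (FaceMap.id n) c = c
  face_comp : ∀ {k m n : ℕ} (f : FaceMap m n) (f' : FaceMap k m) (c : Cube n),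
    face (f.comp f') c = face f' (face f c)
  face_free : ∀ {n : ℕ} (f : FaceMap n n) (c : Cube n), face f c = c → f = FaceMap.id n

namespace CubeComplex

/-- The vertices of a cube complex. -/
abbrev Vertex (X : CubeComplex) := X.Cube 0

/-- The oriented edges of a cube complex. -/
abbrev Edge (X : CubeComplex) := X.Cube 1

variable (X : CubeComplex)

/-- The vertex of the cube `c` with coordinates `t`. -/
def vertex {n : ℕ} (c : X.Cube n) (t : Fin n → Bool) : X.Vertex := X.face (FaceMap.vertex t) c

/-- The oriented edge of the cube `c` through the vertex `t` in direction `i`. -/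
def edge {n : ℕ} (c : X.Cube n) (t : Fin n → Bool) (i : Fin n) : X.Edge :=
  X.face (FaceMap.edge t i) c

/-- The initial vertex of an oriented edge. -/
def source (e : X.Edge) : X.Vertex := X.vertex e (fun _ => false)

/-- The terminal vertex of an oriented edge. -/
def target (e : X.Edge) : X.Vertex := X.vertex e (fun _ => true)

/-- The same edge with the opposite orientation. -/
def reverse (e : X.Edge) : X.Edge := X.face FaceMap.flip e

/-! ### Links and nonpositive curvature -/

/-- The vertices of the link of a vertex `v` are the oriented edges that start at `v`; two of them
are joined in the link by the corner at the origin of each square that they span. -/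
def LinkAdj (e e' : X.Edge) : Prop :=
  ∃ s : X.Cube 2, X.edge s (fun _ => false) 0 = e ∧ X.edge s (fun _ => false) 1 = e'

/-- Gromov's link condition: the link of every vertex is a flag simplicial complex.  That is, no
edge of a link is a loop, and any finite family of pairwise adjacent vertices of the link of `v`
spans exactly one simplex, which means that it is the family of the edges at the corner `v` of
exactly one (parametrized) cube. -/
def IsNonpositivelyCurved : Prop :=
  (∀ e : X.Edge, ¬ X.LinkAdj e e) ∧
  ∀ (n : ℕ) (v : X.Vertex) (e : Fin n → X.Edge), (∀ i, X.source (e i) = v) →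
    (∀ i j, i ≠ j → X.LinkAdj (e i) (e j)) →
    ∃! c : X.Cube n, X.vertex c (fun _ => false) = v ∧ ∀ i, X.edge c (fun _ => false) i = e i

/-! ### Simple connectivity, through the edge-path groupoid -/

/-- The quiver of oriented edges. -/
instance edgeQuiver : Quiver (X.Cube 0) :=
  ⟨fun u v => {e : X.Cube 1 // X.source e = u ∧ X.target e = v}⟩

/-- Homotopy of edge paths relative to their endpoints: the congruence generated by cancelling an
edge followed by its reverse, and by pushing a path across a square. -/
inductive Homotopic : ∀ {u v : X.Vertex}, Quiver.Path u v → Quiver.Path u v → Prop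
  | refl {u v : X.Vertex} (p : Quiver.Path u v) : Homotopic p p
  | symm {u v : X.Vertex} {p q : Quiver.Path u v} : Homotopic p q → Homotopic q p
  | trans {u v : X.Vertex} {p q r : Quiver.Path u v} :
      Homotopic p q → Homotopic q r → Homotopic p r
  | comp {u v w : X.Vertex} {p p' : Quiver.Path u v} {q q' : Quiver.Path v w} :
      Homotopic p p' → Homotopic q q' → Homotopic (p.comp q) (p'.comp q')
  | backtrack {u v : X.Vertex} (e : u ⟶ v) (e' : v ⟶ u) :
      e'.1 = X.reverse e.1 → Homotopic ((Quiver.Path.nil.cons e).cons e') Quiver.Path.nil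
  | square {u v v' w : X.Vertex} (s : X.Cube 2) (a : u ⟶ v) (b : v ⟶ w) (a' : u ⟶ v')
      (b' : v' ⟶ w) :
      a.1 = X.edge s ![false, false] 0 → b.1 = X.edge s ![true, false] 1 →
      a'.1 = X.edge s ![false, false] 1 → b'.1 = X.edge s ![false, true] 0 →
      Homotopic ((Quiver.Path.nil.cons a).cons b) ((Quiver.Path.nil.cons a').cons b')

/-- A cube complex is simply connected if it is non-empty, any two vertices are joined by an edge
path, and any two edge paths with the same endpoints are homotopic. -/
def IsSimplyConnected : Prop :=
  Nonempty X.Vertex ∧ ∀ u v : X.Vertex, Nonempty (Quiver.Path u v) ∧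
    ∀ p q : Quiver.Path u v, X.Homotopic p q

/-- A cube complex is CAT(0) if it is nonpositively curved and simply connected. -/
def IsCAT0 : Prop := X.IsNonpositivelyCurved ∧ X.IsSimplyConnected

/-! ### The combinatorial metric, hyperplanes and half-spaces -/

/-- The `1`-skeleton as a simple graph.  Its `dist` is the combinatorial metric. -/
def skeleton : SimpleGraph X.Vertex where
  Adj u v := u ≠ v ∧ ∃ e : X.Edge,
    (X.source e = u ∧ X.target e = v) ∨ (X.source e = v ∧ X.target e = u)
  symm := ⟨fun _ _ h => ⟨h.1.symm, h.2.imp fun _ he => he.symm⟩⟩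
  loopless := ⟨fun _ h => h.1 rfl⟩

/-- One step of parallelism: the two orientations of an edge, or opposite edges of a square. -/
inductive ParallelStep : X.Edge → X.Edge → Prop
  | reverse (e : X.Edge) : ParallelStep e (X.reverse e)
  | opposite (s : X.Cube 2) (t t' : Fin 2 → Bool) (i : Fin 2) :
      ParallelStep (X.edge s t i) (X.edge s t' i)

/-- Two edges are parallel if they are dual to the same hyperplane.  The hyperplanes (connected
unions of midcubes) correspond to the classes of this equivalence relation. -/
def Parallel (e e' : X.Edge) : Prop := Relation.EqvGen X.ParallelStep e e'

/-- The graph of the complement of the hyperplane dual to `e`: the `1`-skeleton without the edges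
that the hyperplane crosses. -/
def cut (e : X.Edge) : SimpleGraph X.Vertex where
  Adj u v := u ≠ v ∧ ∃ e' : X.Edge, ¬ X.Parallel e e' ∧
    ((X.source e' = u ∧ X.target e' = v) ∨ (X.source e' = v ∧ X.target e' = u))
  symm := ⟨fun _ _ h => ⟨h.1.symm, h.2.imp fun _ he => ⟨he.1, he.2.symm⟩⟩⟩
  loopless := ⟨fun _ h => h.1 rfl⟩

/-- Half-spaces, as sets of vertices: the components of the complement of a hyperplane.  The
opposite half-space is the complementary set of vertices. -/
def IsHalfSpace (H : Set X.Vertex) : Prop :=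
  ∃ (e : X.Edge) (K : (X.cut e).ConnectedComponent), H = K.supp

/-! ### Subcomplexes and dimension -/

/-- A subcomplex: a set of cubes that is closed under faces and reparametrizations. -/
structure Subcomplex where
  cubes : ∀ n : ℕ, Set (X.Cube n)
  face_mem : ∀ {m n : ℕ} (f : FaceMap m n) {c : X.Cube n}, c ∈ cubes n → X.face f c ∈ cubes m

/-- The dimension of a subcomplex: the supremum of the dimensions of its cubes. -/
noncomputable def Subcomplex.dim {X : CubeComplex} (Y : X.Subcomplex) : ℕ∞ :=
  ⨆ (n : ℕ) (_ : (Y.cubes n).Nonempty), (n : ℕ∞)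

theorem vertex_face {m n : ℕ} (f : FaceMap m n) (c : X.Cube n) (t : Fin m → Bool) :
    X.vertex (X.face f c) t = X.vertex c (f.toFun t) := by
  unfold vertex
  rw [← X.face_comp]
  rfl

/-- The full subcomplex generated by a set of vertices. -/
def full (S : Set X.Vertex) : X.Subcomplex where
  cubes n := {c | ∀ t, X.vertex c t ∈ S}
  face_mem f c hc t := by
    rw [X.vertex_face]
    exact hc _

end CubeComplex

/-! ### The Sageev construction -/

/-- The cube complex obtained from a graph by adding a cube whenever its `1`-skeleton is present. -/
def SimpleGraph.cubeComplex {V : Type*} (G : SimpleGraph V) : CubeComplex where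
  Cube n := {c : (Fin n → Bool) → V //
    Function.Injective c ∧ ∀ x y, hammingDist x y = 1 → G.Adj (c x) (c y)}
  face f c := ⟨fun x => c.1 (f.toFun x), fun x y h => by
      have h1 := f.isometry' x y
      rw [c.2.1 h, hammingDist_self] at h1
      exact hammingDist_eq_zero.1 h1.symm,
    fun x y h => c.2.2 _ _ (by rw [f.isometry', h])⟩
  face_id _ := rfl
  face_comp _ _ _ := rfl
  face_free f c h := by
    apply FaceMap.ext
    funext x
    exact c.2.1 (congrFun (congrArg Subtype.val h) x)

namespace Sageev

variable {V : Type*}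

/-- An ultrafilter on a family `A` of half-spaces: it contains exactly one half-space of each pair
`{H, Hᶜ}`, and no two of its elements are disjoint. -/
structure IsUltrafilter (A σ : Set (Set V)) : Prop where
  subset : σ ⊆ A
  exactly_one : ∀ H ∈ A, Xor (H ∈ σ) (Hᶜ ∈ σ)
  inter_nonempty : ∀ H ∈ σ, ∀ K ∈ σ, (H ∩ K).Nonempty

/-- The principal ultrafilter of `v`, restricted to the family `A`. -/
def principal (A : Set (Set V)) (v : V) : Set (Set V) := {H | H ∈ A ∧ v ∈ H}

/-- The vertices of the complex `X(A)`: the ultrafilters on `A` that differ in finitely many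
elements from the one defined by some vertex `v`. -/
def Vertex (A : Set (Set V)) : Type _ :=
  {σ : Set (Set V) // IsUltrafilter A σ ∧ ∃ v, (symmDiff σ (principal A v)).Finite}

/-- Two ultrafilters are adjacent if they differ on exactly one pair `{H, Hᶜ}`. -/
def graph (A : Set (Set V)) : SimpleGraph (Vertex A) where
  Adj σ τ := ∃ H ∈ A, symmDiff σ.1 τ.1 = {H, Hᶜ}
  symm := ⟨fun σ τ h => by
    obtain ⟨H, hA, h⟩ := h
    exact ⟨H, hA, by rw [symmDiff_comm, h]⟩⟩
  loopless := ⟨fun σ h => by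
    obtain ⟨H, -, h⟩ := h
    rw [symmDiff_self] at h
    exact (Set.insert_nonempty H {Hᶜ}).ne_empty h.symm⟩

/-- The cube complex `X(A)` of the Sageev construction. -/
def complex (A : Set (Set V)) : CubeComplex := (graph A).cubeComplex

/-- The restriction map from vertices to the vertices of `X(A)`. -/
def restrict (A : Set (Set V)) (hA : ∀ H ∈ A, Hᶜ ∈ A) (v : V) : Vertex A :=
  ⟨principal A v, ⟨fun _ h => h.1, fun H hH => by
      by_cases hv : v ∈ H
      · exact Or.inl ⟨⟨hH, hv⟩, fun h => h.2 hv⟩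
      · exact Or.inr ⟨⟨hA H hH, hv⟩, fun h => hv h.2⟩,
    fun H hH K hK => ⟨v, hH.2, hK.2⟩⟩, v, by simp⟩

end Sageev

namespace CubeComplex

/-- An automorphism of a cube complex: a bijection on the parametrized cubes of each dimension that
commutes with the face maps. -/
structure Automorphism (X : CubeComplex) where
  toEquiv : ∀ n : ℕ, X.Cube n ≃ X.Cube n
  map_face : ∀ {m n : ℕ} (f : FaceMap m n) (c : X.Cube n),
    toEquiv m (X.face f c) = X.face f (toEquiv n c)

namespace Automorphism

variable {X : CubeComplex} (g : X.Automorphism)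

/-- The action on vertices. -/
def onVertex : X.Vertex ≃ X.Vertex := g.toEquiv 0

/-- `g` acts with inversion if it maps some half-space to the opposite half-space. -/
def ActsWithInversion : Prop := ∃ H : Set X.Vertex, X.IsHalfSpace H ∧ g.onVertex '' H = Hᶜ

/-- The combinatorial translation length: the minimum of `d(x, g x)` over all vertices `x`. -/
noncomputable def translationLength : ℕ :=
  sInf (Set.range fun x : X.Vertex => X.skeleton.dist x (g.onVertex x))

/-- `g` is hyperbolic if it acts without inversion and its translation length is positive. -/
def IsHyperbolic : Prop := ¬ g.ActsWithInversion ∧ 0 < g.translationLength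

/-- A combinatorial axis of `g`, with its forward orientation: a bi-infinite combinatorial
geodesic on which `g` acts as the translation by its translation length. -/
def IsAxis (γ : ℤ → X.Vertex) : Prop :=
  (∀ i j : ℤ, (X.skeleton.dist (γ i) (γ j) : ℤ) = |i - j|) ∧
  ∀ i : ℤ, g.onVertex (γ i) = γ (i + g.translationLength)

/-- The positive half-space axis: the half-spaces dual to positively oriented edges in
combinatorial axes of `g`. -/
def positiveHalfSpaces : Set (Set X.Vertex) :=
  {H | X.IsHalfSpace H ∧ ∃ γ, g.IsAxis γ ∧ ∃ i : ℤ, γ i ∉ H ∧ γ (i + 1) ∈ H}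

/-- The full half-space axis: the half-spaces in the positive half-space axis and their opposite
half-spaces. -/
def axisHalfSpaces : Set (Set X.Vertex) :=
  {H | H ∈ g.positiveHalfSpaces ∨ Hᶜ ∈ g.positiveHalfSpaces}

theorem compl_mem_axisHalfSpaces (H : Set X.Vertex) (hH : H ∈ g.axisHalfSpaces) :
    Hᶜ ∈ g.axisHalfSpaces := by
  rcases hH with h | h
  · exact Or.inr (by rwa [compl_compl])
  · exact Or.inl h

/-- The minimal set: the full subcomplex generated by the vertices that realize the translation
length. -/
noncomputable def minimalSet : X.Subcomplex :=
  X.full {x | X.skeleton.dist x (g.onVertex x) = g.translationLength}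

/-- The essential characteristic set: the complex of the Sageev construction on the full
half-space axis. -/
def essentialCharacteristicSet : CubeComplex := Sageev.complex g.axisHalfSpaces

/-- The projection to the essential characteristic set, on vertices: it restricts the principal
ultrafilter of a vertex to the full half-space axis. -/
def proj (v : X.Vertex) : Sageev.Vertex g.axisHalfSpaces :=
  Sageev.restrict g.axisHalfSpaces g.compl_mem_axisHalfSpaces v

/-- The essential minimal set: the projection of the minimal set to the essential characteristic
set.  A cube of the latter is a map from the vertices `t` of the standard cube to ultrafilters; it
belongs to the projection if it is the image of a cube of the minimal set.  (A cube that is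
collapsed in some directions has the same image as a face that is not collapsed.) -/
noncomputable def essentialMinimalSet : g.essentialCharacteristicSet.Subcomplex where
  cubes n := {c | ∃ b ∈ g.minimalSet.cubes n, ∀ t, c.1 t = g.proj (X.vertex b t)}
  face_mem f c hc := by
    obtain ⟨b, hb, h⟩ := hc
    refine ⟨X.face f b, g.minimalSet.face_mem f hb, fun t => ?_⟩
    rw [X.vertex_face]
    exact h _

end Automorphism

end CubeComplex

/-!
A cube `b` of the minimal set that survives in the Sageev complex with its full dimension `n` has in
each direction `i` a half-space `H i` of the positive half-space axis that is entered by the edges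
of `b` in this direction (`exists_positiveHalfSpace`).  The `H i` are distinct, and some corner `x`
of `b` lies in none of them.  All `H i` contain `g x` (`onVertex_mem_of_adj`), so that `n` distinct
half-spaces separate `x` from `g x`; since an edge enters at most one half-space
(`encard_separating_le`), `n ≤ d(x, g x) = ℓ_g` (`le_translationLength`).

That `H i` contains `g x` rests on the fact that the orbit of a vertex `y` realizing the translation
length never leaves a half-space `H` of the positive half-space axis (`onVertex_mem_of_mem`).  The
orbit lies on a geodesic, hence it would leave `H` for good.  As the axis that enters `H` stays at
bounded distance from the orbit but ends in `H`, infinitely many translates of `H` would separate a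
vertex of this axis from `y`.  If now the edge from `x` to `y` enters `H` but `g x ∉ H`, then the
edge from `g x` to `g y` enters `H` too; both `H` and `g H` are determined by this edge, so that
`g H = H`, which is impossible for a half-space that an axis crosses.

All of this uses a single fact about CAT(0) cube complexes: a half-space `H` that is left by an edge
from `u` to `v` consists of the vertices that are closer to `u` than to `v`
(`IsHalfSpace.mem_iff`).  This follows from the quadrangle condition (`exists_dist_eq`): two edges
that lead from a vertex towards a base vertex `o` span a square whose opposite corner is closer to
`o` by two.  To prove it, edge paths from `o` are considered up to pushing them across squares.  By
the link condition, two such classes of paths with a common extension diverge only by a square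
(`PathClass.cons_eq_cons`).  Hence extending a path by an edge, or cancelling the edge if possible,
gives a well-defined action of edges on classes of reduced paths, which respects backtracks and
squares.  By simple connectivity, this action depends only on the endpoints of an edge path, so that
each vertex is the endpoint of exactly one class of reduced paths from `o`
(`PathClass.exists_normalForm`), namely the class of all geodesics.
-/

namespace CubeComplex

variable {X : CubeComplex}

/-! ### Squares and cubes spanned by edges -/

theorem edge_face {m n : ℕ} (f : FaceMap m n) (c : X.Cube n) {t : Fin m → Bool} {i : Fin m}
    {t' : Fin n → Bool} {j : Fin n}
    (h : ∀ b, f.toFun (Function.update t i b) = Function.update t' j b) :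
    X.edge (X.face f c) t i = X.edge c t' j := by
  unfold edge
  rw [← X.face_comp]
  congr 1
  ext1
  funext x
  exact h (x 0)

theorem edge_face_reverse {m n : ℕ} (f : FaceMap m n) (c : X.Cube n) {t : Fin m → Bool}
    {i : Fin m} {t' : Fin n → Bool} {j : Fin n}
    (h : ∀ b, f.toFun (Function.update t i b) = Function.update t' j (!b)) :
    X.edge (X.face f c) t i = X.reverse (X.edge c t' j) := by
  unfold reverse edge
  rw [← X.face_comp, ← X.face_comp]
  congr 1
  ext1
  funext x
  exact h (x 0)

theorem source_edge {n : ℕ} (c : X.Cube n) (t : Fin n → Bool) (i : Fin n) :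
    X.source (X.edge c t i) = X.vertex c (Function.update t i false) :=
  X.vertex_face _ _ _

theorem target_edge {n : ℕ} (c : X.Cube n) (t : Fin n → Bool) (i : Fin n) :
    X.target (X.edge c t i) = X.vertex c (Function.update t i true) :=
  X.vertex_face _ _ _

@[simp]
theorem source_reverse (e : X.Edge) : X.source (X.reverse e) = X.target e :=
  X.vertex_face _ _ _

@[simp]
theorem target_reverse (e : X.Edge) : X.target (X.reverse e) = X.source e :=
  X.vertex_face _ _ _

@[simp]
theorem reverse_reverse (e : X.Edge) : X.reverse (X.reverse e) = e := by
  unfold reverse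
  rw [← X.face_comp]
  convert X.face_id e using 2
  ext x j
  simp [FaceMap.comp, FaceMap.flip, FaceMap.id]

/-- The edges `e` and `f` are the two edges at a corner of a square, `e'` is the edge opposite to
`e` and `f'` the edge opposite to `f`, oriented so that `e` followed by `f'` and `f` followed by
`e'` are the two sides of the square from this corner to the opposite one. -/
def SquareAt (X : CubeComplex) (e f e' f' : X.Edge) : Prop :=
  ∃ s : X.Cube 2, X.edge s ![false, false] 0 = e ∧ X.edge s ![false, false] 1 = f ∧
    X.edge s ![false, true] 0 = e' ∧ X.edge s ![true, false] 1 = f'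

namespace SquareAt

variable {e f e' f' : X.Edge}

theorem source_eq (h : X.SquareAt e f e' f') : X.source e = X.source f := by
  obtain ⟨s, rfl, rfl, rfl, rfl⟩ := h
  rw [source_edge, source_edge]
  congr 1
  decide

theorem source_left (h : X.SquareAt e f e' f') : X.source e' = X.target f := by
  obtain ⟨s, rfl, rfl, rfl, rfl⟩ := h
  rw [source_edge, target_edge]
  congr 1
  decide

theorem source_right (h : X.SquareAt e f e' f') : X.source f' = X.target e := by
  obtain ⟨s, rfl, rfl, rfl, rfl⟩ := h
  rw [source_edge, target_edge]
  congr 1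
  decide

theorem target_eq (h : X.SquareAt e f e' f') : X.target e' = X.target f' := by
  obtain ⟨s, rfl, rfl, rfl, rfl⟩ := h
  rw [target_edge, target_edge]
  congr 1
  decide

/-- The reflection of a square in its diagonal. -/
theorem swap (h : X.SquareAt e f e' f') : X.SquareAt f e f' e' := by
  obtain ⟨s, rfl, rfl, rfl, rfl⟩ := h
  refine ⟨X.face ⟨fun x => ![x 1, x 0], by decide⟩ s, ?_, ?_, ?_, ?_⟩ <;>
  · apply edge_face
    decide

/-- The same square, seen from the endpoint of `e`. -/
theorem reflect (h : X.SquareAt e f e' f') :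
    X.SquareAt (X.reverse e) f' (X.reverse e') f := by
  obtain ⟨s, rfl, rfl, rfl, rfl⟩ := h
  refine ⟨X.face ⟨fun x => ![!x 0, x 1], by decide⟩ s, ?_, ?_, ?_, ?_⟩
  · apply edge_face_reverse
    decide
  · apply edge_face
    decide
  · apply edge_face_reverse
    decide
  · apply edge_face
    decide

theorem linkAdj (h : X.SquareAt e f e' f') : X.LinkAdj e f := by
  obtain ⟨s, rfl, rfl, rfl, rfl⟩ := h
  exact ⟨s, by congr 1; decide, by congr 1; decide⟩

theorem ne (hX : X.IsNonpositivelyCurved) (h : X.SquareAt e f e' f') : e ≠ f := by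
  rintro rfl
  exact hX.1 e h.linkAdj

/-- A square is determined by its edges at one corner. -/
theorem unique (hX : X.IsNonpositivelyCurved) {e₁ f₁ : X.Edge} (h : X.SquareAt e f e' f')
    (h₁ : X.SquareAt e f e₁ f₁) : e' = e₁ ∧ f' = f₁ := by
  have hef := h.source_eq
  have hl := h.linkAdj
  have hl' := h.swap.linkAdj
  obtain ⟨s, hs, hs', rfl, rfl⟩ := h
  obtain ⟨s₁, hs₁, hs₁', rfl, rfl⟩ := h₁
  have key := hX.2 2 (X.source e) ![e, f] (by simp [Fin.forall_fin_two, hef])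
    (by simp [Fin.forall_fin_two, hl, hl'])
  have h0 : (fun _ => false : Fin 2 → Bool) = ![false, false] := by decide
  have hc : ∀ s : X.Cube 2, X.edge s ![false, false] 0 = e → X.edge s ![false, false] 1 = f →
      X.vertex s (fun _ => false) = X.source e ∧
        ∀ i, X.edge s (fun _ => false) i = ![e, f] i := by
    intro s hs hs'
    refine ⟨?_, by simp [Fin.forall_fin_two, h0, hs, hs']⟩
    rw [← hs, source_edge]
    congr 1
    decide
  rw [key.unique (hc s hs hs') (hc s₁ hs₁ hs₁')]
  exact ⟨rfl, rfl⟩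

/-- Three squares that pairwise share an edge at a common corner are three faces of a cube: the
three opposite faces exist. -/
theorem exists_cube (hX : X.IsNonpositivelyCurved) {a b c ab ac ba bc ca cb : X.Edge}
    (hab : X.SquareAt a b ab ba) (hac : X.SquareAt a c ac ca) (hbc : X.SquareAt b c bc cb) :
    ∃ a' b' c', X.SquareAt ba ca b' c' ∧ X.SquareAt ab cb a' c' ∧ X.SquareAt ac bc a' b' := by
  obtain ⟨q, ⟨-, hq⟩, -⟩ := hX.2 3 (X.source a) ![a, b, c]
    (by simp [Fin.forall_fin_succ, hab.source_eq, ← hac.source_eq])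
    (by simp [Fin.forall_fin_succ, hab.linkAdj, hac.linkAdj, hbc.linkAdj, hab.swap.linkAdj,
      hac.swap.linkAdj, hbc.swap.linkAdj])
  have h0 : (fun _ => false : Fin 3 → Bool) = ![false, false, false] := by decide
  simp only [h0] at hq
  have ha : X.edge q ![false, false, false] 0 = a := hq 0
  have hb : X.edge q ![false, false, false] 1 = b := hq 1
  have hc : X.edge q ![false, false, false] 2 = c := hq 2
  -- The faces of the cube at the given corner, and the faces opposite to them.
  have fab (r : Bool) : X.SquareAt (X.edge q ![false, false, r] 0) (X.edge q ![false, false, r] 1)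
      (X.edge q ![false, true, r] 0) (X.edge q ![true, false, r] 1) := by
    refine ⟨X.face ⟨fun x => ![x 0, x 1, r], by revert r; decide⟩ q, ?_, ?_, ?_, ?_⟩ <;>
    · apply edge_face
      revert r
      decide
  have fac (r : Bool) : X.SquareAt (X.edge q ![false, r, false] 0) (X.edge q ![false, r, false] 2)
      (X.edge q ![false, r, true] 0) (X.edge q ![true, r, false] 2) := by
    refine ⟨X.face ⟨fun x => ![x 0, r, x 1], by revert r; decide⟩ q, ?_, ?_, ?_, ?_⟩ <;>
    · apply edge_face
      revert r
      decide
  have fbc (r : Bool) : X.SquareAt (X.edge q ![r, false, false] 1) (X.edge q ![r, false, false] 2)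
      (X.edge q ![r, false, true] 1) (X.edge q ![r, true, false] 2) := by
    refine ⟨X.face ⟨fun x => ![r, x 0, x 1], by revert r; decide⟩ q, ?_, ?_, ?_, ?_⟩ <;>
    · apply edge_face
      revert r
      decide
  have gab := fab false
  have gac := fac false
  have gbc := fbc false
  rw [ha, hb] at gab
  rw [ha, hc] at gac
  rw [hb, hc] at gbc
  obtain ⟨rfl, rfl⟩ := hab.unique hX gab
  obtain ⟨rfl, rfl⟩ := hac.unique hX gac
  obtain ⟨rfl, rfl⟩ := hbc.unique hX gbc
  exact ⟨_, _, _, fbc true, fac true, fab true⟩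

end SquareAt

/-! ### Edge paths up to pushing across squares -/

/-- Edge paths up to pushing across squares.  A path is the list of its edges in backward
orientation, beginning with the last one, so that the head of the list starts at the endpoint of
the path.  No condition ties consecutive edges together here; see `Reduced` for that. -/
inductive SquareEquiv (X : CubeComplex) : List X.Edge → List X.Edge → Prop
  | nil : SquareEquiv X [] []
  | cons (e : X.Edge) {p q : List X.Edge} : SquareEquiv X p q → SquareEquiv X (e :: p) (e :: q)
  | square {e f e' f' : X.Edge} (p : List X.Edge) : X.SquareAt e f e' f' →
      SquareEquiv X (e :: f' :: p) (f :: e' :: p)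
  | trans {p q r : List X.Edge} : SquareEquiv X p q → SquareEquiv X q r → SquareEquiv X p r

namespace SquareEquiv

theorem refl : ∀ p : List X.Edge, X.SquareEquiv p p
  | [] => nil
  | e :: p => cons e (refl p)

theorem symm {p q : List X.Edge} (h : X.SquareEquiv p q) : X.SquareEquiv q p := by
  induction h with
  | nil => exact nil
  | cons e _ ih => exact cons e ih
  | square p h => exact square p h.swap
  | trans _ _ ih ih' => exact ih'.trans ih

theorem length_eq {p q : List X.Edge} (h : X.SquareEquiv p q) : p.length = q.length := by
  induction h with
  | nil => rfl
  | cons e _ ih => simp [ih]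
  | square p h => rfl
  | trans _ _ ih ih' => exact ih.trans ih'

/-- If two equivalent paths end with different edges, then these edges span a square, and both
paths arrive through that square.  The transitivity of this relation between equivalent paths is
where the link condition enters: two successive squares produce, by induction on the length, a
third one, and the three squares lie in a cube. -/
theorem cons_cons (hX : X.IsNonpositivelyCurved) : ∀ (n : ℕ) {p q : List X.Edge},
    X.SquareEquiv p q → p.length ≤ n → ∀ {e f : X.Edge} {p' q' : List X.Edge},
    p = e :: p' → q = f :: q' → (e = f ∧ X.SquareEquiv p' q') ∨
      ∃ e' f' r, X.SquareAt e f e' f' ∧ X.SquareEquiv p' (f' :: r) ∧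
        X.SquareEquiv q' (e' :: r) := by
  intro n
  induction n with
  | zero =>
    rintro p q - hn e f p' q' rfl -
    simp at hn
  | succ n ihn =>
    intro p q h
    induction h with
    | nil => intro _ _ _ _ _ h; cases h
    | cons e h =>
      rintro - e f p' q' ⟨⟩ ⟨⟩
      exact Or.inl ⟨rfl, h⟩
    | square p h =>
      rintro - e f p' q' ⟨⟩ ⟨⟩
      exact Or.inr ⟨_, _, p, h, refl _, refl _⟩
    | @trans p m q hpm hmq ih ih' =>
      rintro hn e h p' r rfl rfl
      have hlen := hpm.length_eq
      obtain _ | ⟨f, q⟩ := m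
      · simp at hlen
      have hn' : (f :: q).length ≤ n + 1 := by omega
      obtain ⟨rfl, hpq⟩ | ⟨e', f₁, w₁, hef, hp, hq⟩ := ih hn rfl rfl
      · obtain ⟨rfl, hqr⟩ | ⟨e₂, h₂, w, hs, hq, hr⟩ := ih' hn' rfl rfl
        · exact Or.inl ⟨rfl, hpq.trans hqr⟩
        · exact Or.inr ⟨e₂, h₂, w, hs, hpq.trans hq, hr⟩
      obtain ⟨rfl, hqr⟩ | ⟨f₂, h', w₂, hfh, hq₂, hr⟩ := ih' hn' rfl rfl
      · exact Or.inr ⟨e', f₁, w₁, hef, hp, hqr.symm.trans hq⟩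
      have hw : X.SquareEquiv (e' :: w₁) (h' :: w₂) := hq.symm.trans hq₂
      have hlen' : (e' :: w₁).length ≤ n := by
        rw [← hq.length_eq]
        simpa using hn'
      obtain ⟨rfl, hw'⟩ | ⟨e₃, h₃, w₃, hs, hw₁, hw₂⟩ := ihn hw hlen' rfl rfl
      · obtain ⟨hf, rfl⟩ := hef.swap.reflect.unique hX hfh.reflect
        have hf' : f₁ = f₂ := by
          rw [← reverse_reverse f₁, hf, reverse_reverse]
        subst hf'
        exact Or.inl ⟨rfl, (hp.trans (cons _ hw')).trans hr.symm⟩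
      · obtain ⟨k, e₄, h₄, hs₁, hs₂, hs₃⟩ :=
          SquareAt.exists_cube hX hef.swap.reflect hfh.reflect hs
        have hs₂' := hs₂.reflect
        have hs₃' := hs₃.reflect
        rw [reverse_reverse] at hs₂' hs₃'
        exact Or.inr ⟨e₄, h₄, X.reverse k :: w₃, hs₁,
          (hp.trans (cons _ hw₁)).trans (square _ hs₂'),
          (hr.trans (cons _ hw₂)).trans (square _ hs₃')⟩

end SquareEquiv

/-- `SquareEquiv` as a setoid. -/
def squareSetoid (X : CubeComplex) : Setoid (List X.Edge) :=
  ⟨X.SquareEquiv, SquareEquiv.refl, SquareEquiv.symm, SquareEquiv.trans⟩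

/-- Edge paths up to pushing across squares, in the encoding of `SquareEquiv`. -/
def PathClass (X : CubeComplex) : Type _ := Quotient X.squareSetoid

namespace PathClass

/-- The constant path. -/
def nil : X.PathClass := Quotient.mk X.squareSetoid []

/-- Extend a path by the reverse of the edge `e`. -/
def cons (e : X.Edge) : X.PathClass → X.PathClass :=
  Quotient.map (List.cons e) fun _ _ h => SquareEquiv.cons e h

/-- The number of edges of a path. -/
def length : X.PathClass → ℕ :=
  Quotient.lift List.length fun _ _ h => SquareEquiv.length_eq h

@[simp]
theorem length_nil : (nil : X.PathClass).length = 0 := rfl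

@[simp]
theorem length_cons (e : X.Edge) (x : X.PathClass) : (cons e x).length = x.length + 1 := by
  induction x using Quotient.inductionOn
  rfl

theorem cons_cons_eq {e f e' f' : X.Edge} (h : X.SquareAt e f e' f') (x : X.PathClass) :
    cons e (cons f' x) = cons f (cons e' x) := by
  induction x using Quotient.inductionOn with
  | h p => exact Quotient.sound (SquareEquiv.square p h)

theorem cons_eq_cons (hX : X.IsNonpositivelyCurved) {e f : X.Edge} {x y : X.PathClass}
    (h : cons e x = cons f y) : (e = f ∧ x = y) ∨
      ∃ e' f' z, X.SquareAt e f e' f' ∧ x = cons f' z ∧ y = cons e' z := by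
  induction x using Quotient.inductionOn with
  | h p =>
  induction y using Quotient.inductionOn with
  | h q =>
  obtain ⟨rfl, h'⟩ | ⟨e', f', r, hs, hp, hq⟩ :=
    SquareEquiv.cons_cons hX _ (Quotient.exact h) le_rfl rfl rfl
  · exact Or.inl ⟨rfl, Quotient.sound h'⟩
  · exact Or.inr ⟨e', f', Quotient.mk _ r, hs, Quotient.sound hp, Quotient.sound hq⟩

theorem cons_injective (hX : X.IsNonpositivelyCurved) (e : X.Edge) :
    Function.Injective (cons e) := by
  intro x y h
  obtain ⟨-, h⟩ | ⟨_, _, _, hs, -⟩ := cons_eq_cons hX h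
  · exact h
  · exact absurd rfl (hs.ne hX)

/-- If two edges at the corner of a square are both last edges of a path, then the path arrives
through this square. -/
theorem eq_cons_of_squareAt (hX : X.IsNonpositivelyCurved) {e f e' f' : X.Edge}
    {x y : X.PathClass} (hs : X.SquareAt e f e' f') (h : cons e x = cons f y) :
    ∃ z, x = cons f' z ∧ y = cons e' z := by
  obtain ⟨rfl, -⟩ | ⟨e₁, f₁, z, hs₁, hx, hy⟩ := cons_eq_cons hX h
  · exact absurd rfl (hs.ne hX)
  · obtain ⟨rfl, rfl⟩ := hs.unique hX hs₁
    exact ⟨z, hx, hy⟩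

/-! ### Reduced paths -/

/-- `Reduced o v x` means that `x` is the class of an edge path from `o` to `v` which cannot be
shortened by cancelling an edge with its reverse, even after pushing it across squares. -/
inductive Reduced (o : X.Vertex) : X.Vertex → X.PathClass → Prop
  | nil : Reduced o o nil
  | cons (e : X.Edge) {x : X.PathClass} : Reduced o (X.target e) x →
      (∀ y, x ≠ cons (X.reverse e) y) → Reduced o (X.source e) (cons e x)

/-- Being reduced does not depend on the representative: every way to write a reduced class as an
extension is an instance of the constructor. -/
theorem Reduced.of_cons (hX : X.IsNonpositivelyCurved) {o v : X.Vertex} {e : X.Edge}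
    {x : X.PathClass} (h : Reduced o v (PathClass.cons e x)) :
    v = X.source e ∧ Reduced o (X.target e) x ∧ ∀ y, x ≠ PathClass.cons (X.reverse e) y := by
  generalize hz : PathClass.cons e x = z at h
  induction h generalizing e x with
  | nil =>
    have := congrArg length hz
    simp at this
  | @cons f y hy hf ih =>
    obtain ⟨rfl, rfl⟩ | ⟨e', f', z, hs, rfl, rfl⟩ := cons_eq_cons hX hz
    · exact ⟨rfl, hy, hf⟩
    obtain ⟨-, h₁, h₂⟩ := ih rfl
    refine ⟨hs.source_eq.symm, ?_, ?_⟩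
    · rw [← hs.source_right]
      refine Reduced.cons f' (hs.target_eq ▸ h₁) ?_
      rintro w rfl
      exact hf _ (cons_cons_eq hs.swap.reflect.swap w)
    · intro w hw
      obtain ⟨u, rfl, -⟩ := eq_cons_of_squareAt hX hs.reflect.swap hw
      exact h₂ _ rfl

open Classical in
/-- Move the endpoint of a path along the edge `e`: cancel `e` if it is possible, and extend the
path otherwise. -/
noncomputable def act (e : X.Edge) (x : X.PathClass) : X.PathClass :=
  if h : ∃ y, x = cons e y then h.choose else cons (X.reverse e) x

theorem act_cons (hX : X.IsNonpositivelyCurved) (e : X.Edge) (x : X.PathClass) :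
    act e (cons e x) = x := by
  have h : ∃ y, cons e x = cons e y := ⟨x, rfl⟩
  rw [act, dif_pos h]
  exact (cons_injective hX e h.choose_spec).symm

theorem act_of_ne {e : X.Edge} {x : X.PathClass} (h : ∀ y, x ≠ cons e y) :
    act e x = cons (X.reverse e) x :=
  dif_neg fun ⟨y, hy⟩ => h y hy

theorem exists_or_forall_ne (e : X.Edge) (x : X.PathClass) :
    (∃ y, x = cons e y) ∨ ∀ y, x ≠ cons e y := by
  by_cases h : ∃ y, x = cons e y
  · exact Or.inl h
  · exact Or.inr fun y hy => h ⟨y, hy⟩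

theorem length_act (hX : X.IsNonpositivelyCurved) (e : X.Edge) (x : X.PathClass) :
    (act e x).length = x.length + 1 ∨ (act e x).length + 1 = x.length := by
  obtain ⟨y, rfl⟩ | h := exists_or_forall_ne e x
  · right
    rw [act_cons hX, length_cons]
  · left
    rw [act_of_ne h, length_cons]

/-- A path whose length drops along `e` has `e` as a last edge. -/
theorem eq_cons_act (hX : X.IsNonpositivelyCurved) {e : X.Edge} {x : X.PathClass}
    (h : (act e x).length < x.length) : x = cons e (act e x) := by
  obtain ⟨y, rfl⟩ | h' := exists_or_forall_ne e x
  · rw [act_cons hX]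
  · rw [act_of_ne h', length_cons] at h
    omega

variable {o : X.Vertex}

theorem Reduced.act (hX : X.IsNonpositivelyCurved) {e : X.Edge} {x : X.PathClass}
    (h : Reduced o (X.source e) x) : Reduced o (X.target e) (act e x) := by
  obtain ⟨y, rfl⟩ | h' := exists_or_forall_ne e x
  · rw [act_cons hX]
    exact (h.of_cons hX).2.1
  · rw [act_of_ne h', ← source_reverse]
    refine .cons _ (by rwa [target_reverse]) ?_
    rwa [reverse_reverse]

theorem Reduced.act_reverse_act (hX : X.IsNonpositivelyCurved) {e : X.Edge} {x : X.PathClass}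
    (h : Reduced o (X.source e) x) : PathClass.act (X.reverse e) (PathClass.act e x) = x := by
  obtain ⟨y, rfl⟩ | h' := exists_or_forall_ne e x
  · rw [act_cons hX, act_of_ne (h.of_cons hX).2.2, reverse_reverse]
  · rw [act_of_ne h', act_cons hX]

theorem Reduced.act_act_of_ne (hX : X.IsNonpositivelyCurved) {e f e' f' : X.Edge}
    {x : X.PathClass} (h : Reduced o (X.source e) x) (hs : X.SquareAt e f e' f')
    (hf : ∀ y, x ≠ PathClass.cons f y) :
    PathClass.act f' (PathClass.act e x) = PathClass.act e' (PathClass.act f x) := by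
  obtain ⟨y, rfl⟩ | he := exists_or_forall_ne e x
  · have hr := (hs.source_eq ▸ h).act hX (e := f)
    rw [act_of_ne hf, cons_cons_eq hs.swap.reflect] at hr ⊢
    have hy := ((hr.of_cons hX).2.1.of_cons hX).2.2
    rw [reverse_reverse] at hy
    rw [act_cons hX, act_cons hX, act_of_ne hy]
  · have hf' : ∀ y, PathClass.cons (X.reverse e) x ≠ PathClass.cons f' y := by
      intro y hy
      obtain ⟨z, hz, -⟩ := eq_cons_of_squareAt hX hs.reflect hy
      exact hf z hz
    have he' : ∀ y, PathClass.cons (X.reverse f) x ≠ PathClass.cons e' y := by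
      intro y hy
      obtain ⟨z, hz, -⟩ := eq_cons_of_squareAt hX hs.swap.reflect hy
      exact he z hz
    rw [act_of_ne he, act_of_ne hf, act_of_ne hf', act_of_ne he',
      cons_cons_eq hs.reflect.swap.reflect]

/-- The two sides of a square move the endpoint of a reduced path in the same way. -/
theorem Reduced.act_act (hX : X.IsNonpositivelyCurved) {e f e' f' : X.Edge}
    {x : X.PathClass} (h : Reduced o (X.source e) x) (hs : X.SquareAt e f e' f') :
    PathClass.act f' (PathClass.act e x) = PathClass.act e' (PathClass.act f x) := by
  obtain ⟨z, hz⟩ | hf := exists_or_forall_ne f x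
  · obtain ⟨y, rfl⟩ | he := exists_or_forall_ne e x
    · obtain ⟨w, rfl, rfl⟩ := eq_cons_of_squareAt hX hs hz
      rw [act_cons hX, hz, act_cons hX, act_cons hX, act_cons hX]
    · rw [hs.source_eq] at h
      exact (h.act_act_of_ne hX hs.swap he).symm
  · exact h.act_act_of_ne hX hs hf

/-- Move the endpoint of a path along an edge path. -/
noncomputable def actPath {u : X.Vertex} : ∀ {v : X.Vertex}, Quiver.Path u v →
    X.PathClass → X.PathClass
  | _, .nil, x => x
  | _, .cons p e, x => act e.1 (actPath p x)

theorem actPath_comp {u v w : X.Vertex} (p : Quiver.Path u v) (q : Quiver.Path v w)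
    (x : X.PathClass) : actPath (p.comp q) x = actPath q (actPath p x) := by
  induction q with
  | nil => rfl
  | cons q e ih =>
    rw [Quiver.Path.comp_cons, actPath, actPath, ih]

theorem Reduced.actPath (hX : X.IsNonpositivelyCurved) {u v : X.Vertex} (p : Quiver.Path u v)
    {x : X.PathClass} (h : Reduced o u x) : Reduced o v (PathClass.actPath p x) := by
  induction p with
  | nil => exact h
  | cons p e ih =>
    obtain ⟨e, rfl, rfl⟩ := e
    exact ih.act hX

/-- Homotopic edge paths act in the same way on reduced paths. -/
theorem Reduced.actPath_eq (hX : X.IsNonpositivelyCurved) {u v : X.Vertex}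
    {p q : Quiver.Path u v} (hpq : X.Homotopic p q) {x : X.PathClass} (h : Reduced o u x) :
    PathClass.actPath p x = PathClass.actPath q x := by
  induction hpq generalizing x with
  | refl p => rfl
  | symm _ ih => exact (ih h).symm
  | trans _ _ ih ih' => exact (ih h).trans (ih' h)
  | @comp _ _ _ p p' q q' _ _ ih ih' =>
    rw [actPath_comp, actPath_comp, ih h, ih' (h.actPath hX p')]
  | backtrack e e' he =>
    obtain ⟨e, rfl, rfl⟩ := e
    obtain ⟨e', he₁, he₂⟩ := e'
    subst he
    exact h.act_reverse_act hX
  | square s a b a' b' ha hb ha' hb' =>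
    obtain ⟨a, rfl, rfl⟩ := a
    exact h.act_act hX ⟨s, ha.symm, ha'.symm, hb'.symm, hb.symm⟩

/-- In a CAT(0) cube complex, there is exactly one class of reduced paths from `o` to each vertex,
and moving the endpoint along an edge permutes these classes. -/
theorem exists_normalForm (hX : X.IsCAT0) (o : X.Vertex) :
    ∃ N : X.Vertex → X.PathClass, N o = nil ∧ (∀ v, Reduced o v (N v)) ∧
      (∀ e, N (X.target e) = act e (N (X.source e))) ∧ ∀ v x, Reduced o v x → x = N v := by
  obtain ⟨hX, -, hsc⟩ := hX
  have h0 : Reduced o o (nil : X.PathClass) := .nil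
  set N : X.Vertex → X.PathClass := fun v => actPath (hsc o v).1.some nil
  have hN {v : X.Vertex} (p : Quiver.Path o v) : N v = actPath p nil :=
    h0.actPath_eq hX ((hsc o v).2 _ _)
  have hNo : N o = nil := hN .nil
  have hNr (v : X.Vertex) : Reduced o v (N v) := h0.actPath hX _
  have hNe (e : X.Edge) : N (X.target e) = act e (N (X.source e)) :=
    hN ((hsc o (X.source e)).1.some.cons ⟨e, rfl, rfl⟩)
  refine ⟨N, hNo, hNr, hNe, fun v x h => ?_⟩
  induction h with
  | nil => exact hNo.symm
  | cons e _ hx ih =>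
    rw [← target_reverse, hNe, source_reverse, ← ih, act_of_ne hx, reverse_reverse]

end PathClass

/-! ### The combinatorial metric -/

theorem adj_of_edge {e : X.Edge} (h : X.source e ≠ X.target e) :
    X.skeleton.Adj (X.source e) (X.target e) :=
  ⟨h, e, Or.inl ⟨rfl, rfl⟩⟩

theorem exists_edge_of_adj {u v : X.Vertex} (h : X.skeleton.Adj u v) :
    ∃ e : X.Edge, X.source e = u ∧ X.target e = v := by
  obtain ⟨-, e, he | he⟩ := h
  · exact ⟨e, he⟩
  · exact ⟨X.reverse e, by rw [source_reverse, he.2], by rw [target_reverse, he.1]⟩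

/-- The metric structure that a CAT(0) cube complex inherits from its reduced paths: the skeleton
is bipartite, and two edges that lead from a vertex towards `o` span a square whose opposite corner
is closer to `o` by two. -/
theorem exists_dist_eq (hX : X.IsCAT0) (o : X.Vertex) :
    (∀ v, X.skeleton.Reachable o v) ∧
    (∀ e, X.skeleton.dist o (X.target e) = X.skeleton.dist o (X.source e) + 1 ∨
      X.skeleton.dist o (X.target e) + 1 = X.skeleton.dist o (X.source e)) ∧
    ∀ e f, X.source e = X.source f → e ≠ f →
      X.skeleton.dist o (X.target e) + 1 = X.skeleton.dist o (X.source e) →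
      X.skeleton.dist o (X.target f) + 1 = X.skeleton.dist o (X.source e) →
      ∃ e' f', X.SquareAt e f e' f' ∧
        X.skeleton.dist o (X.target e') + 2 = X.skeleton.dist o (X.source e) := by
  obtain ⟨N, hNo, hNr, hNe, hNu⟩ := PathClass.exists_normalForm hX o
  have hX := hX.1
  have hstep (e : X.Edge) : (N (X.target e)).length = (N (X.source e)).length + 1 ∨
      (N (X.target e)).length + 1 = (N (X.source e)).length := by
    rw [hNe]
    exact PathClass.length_act hX _ _
  have hadj (e : X.Edge) : X.skeleton.Adj (X.source e) (X.target e) := by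
    refine adj_of_edge fun h => ?_
    have := hstep e
    rw [h] at this
    omega
  have hle {u v : X.Vertex} (p : X.skeleton.Walk u v) :
      (N v).length ≤ (N u).length + p.length := by
    induction p with
    | nil => simp
    | cons h p ih =>
      obtain ⟨e, rfl, rfl⟩ := exists_edge_of_adj h
      have := hstep e
      rw [SimpleGraph.Walk.length_cons]
      omega
  have hwalk {v : X.Vertex} {x : X.PathClass} (h : PathClass.Reduced o v x) :
      ∃ p : X.skeleton.Walk o v, p.length = x.length := by
    induction h with
    | nil => exact ⟨.nil, rfl⟩
    | cons e _ _ ih =>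
      obtain ⟨p, hp⟩ := ih
      exact ⟨p.concat (hadj e).symm, by simp [hp]⟩
  have hreach (v : X.Vertex) : X.skeleton.Reachable o v := (hwalk (hNr v)).elim fun p _ => ⟨p⟩
  have hd (v : X.Vertex) : X.skeleton.dist o v = (N v).length := by
    apply le_antisymm
    · obtain ⟨p, hp⟩ := hwalk (hNr v)
      exact hp ▸ SimpleGraph.dist_le p
    · obtain ⟨p, hp⟩ := (hreach v).exists_walk_length_eq_dist
      have := hle p
      rw [hNo, PathClass.length_nil] at this
      omega
  refine ⟨hreach, fun e => by rw [hd, hd]; exact hstep e, fun e f hef hne he hf => ?_⟩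
  rw [hd, hd] at he hf
  have he' : N (X.source e) = PathClass.cons e (N (X.target e)) := by
    rw [hNe e]
    exact PathClass.eq_cons_act hX (by rw [← hNe]; omega)
  have hf' : N (X.source e) = PathClass.cons f (N (X.target f)) := by
    rw [hef, hNe f]
    exact PathClass.eq_cons_act hX (by rw [← hNe, ← hef]; omega)
  obtain ⟨rfl, -⟩ | ⟨e', f', z, hs, hz, hz'⟩ := PathClass.cons_eq_cons hX (he'.symm.trans hf')
  · exact absurd rfl hne
  refine ⟨e', f', hs, ?_⟩
  have hr := hNr (X.target f)
  rw [hz'] at hr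
  rw [hd, hd, ← hNu _ _ (hr.of_cons hX).2.1, he', hz, PathClass.length_cons,
    PathClass.length_cons]

theorem skeleton_connected (hX : X.IsCAT0) : X.skeleton.Connected :=
  haveI := hX.2.1
  ⟨fun o => (exists_dist_eq hX o).1⟩

theorem dist_target (hX : X.IsCAT0) (x : X.Vertex) (e : X.Edge) :
    X.skeleton.dist x (X.target e) = X.skeleton.dist x (X.source e) + 1 ∨
      X.skeleton.dist x (X.target e) + 1 = X.skeleton.dist x (X.source e) :=
  (exists_dist_eq hX x).2.1 e

theorem dist_source_target (hX : X.IsCAT0) (e : X.Edge) :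
    X.skeleton.dist (X.source e) (X.target e) = 1 := by
  have := dist_target hX (X.source e) e
  rw [SimpleGraph.dist_self] at this
  omega

theorem exists_edge_toward (hX : X.IsCAT0) {o v : X.Vertex} {k : ℕ}
    (h : X.skeleton.dist o v = k + 1) :
    ∃ e, X.source e = v ∧ X.skeleton.dist o (X.target e) = k := by
  obtain ⟨p, hp⟩ := (skeleton_connected hX).exists_walk_length_eq_dist v o
  rw [SimpleGraph.dist_comm, h] at hp
  cases p with
  | nil => simp at hp
  | cons hadj p =>
    obtain ⟨e, rfl, rfl⟩ := exists_edge_of_adj hadj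
    refine ⟨e, rfl, ?_⟩
    rw [SimpleGraph.Walk.length_cons] at hp
    have h₁ := SimpleGraph.dist_le p
    rw [SimpleGraph.dist_comm] at h₁
    have h₂ := dist_target hX o e
    omega

/-! ### Half-spaces -/

/-- The vertices that are closer to the initial than to the terminal vertex of an edge. -/
def side (X : CubeComplex) (e : X.Edge) : Set X.Vertex :=
  {x | X.skeleton.dist x (X.source e) < X.skeleton.dist x (X.target e)}

theorem mem_side {e : X.Edge} {x : X.Vertex} :
    x ∈ X.side e ↔ X.skeleton.dist x (X.source e) < X.skeleton.dist x (X.target e) :=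
  Iff.rfl

theorem side_reverse (hX : X.IsCAT0) (e : X.Edge) : X.side (X.reverse e) = (X.side e)ᶜ := by
  ext x
  have := dist_target hX x e
  rw [Set.mem_compl_iff, mem_side, mem_side, source_reverse, target_reverse]
  omega

theorem source_mem_side (hX : X.IsCAT0) (e : X.Edge) : X.source e ∈ X.side e := by
  rw [mem_side, SimpleGraph.dist_self, dist_source_target hX]
  exact one_pos

theorem target_notMem_side (e : X.Edge) : X.target e ∉ X.side e := by
  rw [mem_side, SimpleGraph.dist_self]
  exact Nat.not_lt_zero _

/-- Opposite edges of a square have the same sides.  If `x` were on different sides, the distance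
from `x` would have a maximum at two opposite corners of the square; but the edges at such a corner
both lead towards `x`, so that the opposite corner is closer to `x` by two. -/
theorem side_eq_of_squareAt (hX : X.IsCAT0) {e f e' f' : X.Edge} (hs : X.SquareAt e f e' f') :
    X.side e = X.side e' := by
  have key : ∀ {e f e' f' : X.Edge}, X.SquareAt e f e' f' → X.side e ⊆ X.side e' := by
    intro e f e' f' hs x hx
    by_contra hx'
    rw [mem_side] at hx hx'
    have h₁ := dist_target hX x e
    have h₂ := dist_target hX x f
    have h₃ := dist_target hX x e'
    have h₄ := dist_target hX x f'
    have hs' := hs.reflect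
    rw [hs.source_left] at hx' h₃
    rw [hs.source_right, ← hs.target_eq] at h₄
    rw [← hs.source_eq] at h₂
    obtain ⟨a, b, hab, ha⟩ := (exists_dist_eq hX x).2.2 (X.reverse e) f' hs'.source_eq
      (hs'.ne hX.1) (by rw [source_reverse, target_reverse]; omega)
      (by rw [source_reverse, ← hs.target_eq]; omega)
    obtain ⟨rfl, -⟩ := hs'.unique hX.1 hab
    rw [source_reverse, target_reverse, hs.source_left] at ha
    omega
  exact (key hs).antisymm (key hs.swap.reflect.swap)

/-- The edges that connect the two sides of `e` are dual to the same hyperplane as `e`. -/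
theorem parallel_of_mem_side (hX : X.IsCAT0) {e : X.Edge} : ∀ {a : X.Edge},
    X.source a ∈ X.side e → X.target a ∉ X.side e → X.Parallel e a := by
  suffices ∀ (k : ℕ) (a : X.Edge), X.skeleton.dist (X.source e) (X.source a) = k →
      X.source a ∈ X.side e → X.target a ∉ X.side e → X.Parallel e a from
    fun {a} => this _ a rfl
  intro k
  induction k with
  | zero =>
    intro a h hs ht
    have hsrc : X.source e = X.source a := (skeleton_connected hX).dist_eq_zero_iff.1 h
    by_cases hea : e = a
    · rw [hea]
      exact .refl a
    -- Two edges with the same endpoints would both lead towards their common target.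
    rw [mem_side] at ht
    have h₁ := dist_source_target hX a
    have h₂ := dist_source_target hX e
    rw [← hsrc, SimpleGraph.dist_comm] at h₁
    have h₃ : X.target a = X.target e := by
      have := dist_target hX (X.target a) e
      rw [← (skeleton_connected hX).dist_eq_zero_iff]
      omega
    rw [SimpleGraph.dist_comm] at h₂
    obtain ⟨_, _, -, h₄⟩ := (exists_dist_eq hX (X.target e)).2.2 e a hsrc hea
      (by rw [SimpleGraph.dist_self, h₂]) (by rw [h₃, SimpleGraph.dist_self, h₂])
    omega
  | succ k ih =>
    intro a h hs ht
    obtain ⟨b, hba, hb⟩ := exists_edge_toward hX h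
    rw [mem_side, SimpleGraph.dist_comm, SimpleGraph.dist_comm (v := X.target e)] at hs ht
    have h₁ := dist_target hX (X.source e) a
    have h₂ := dist_target hX (X.target e) a
    have h₃ := dist_target hX (X.target e) b
    have h₄ := dist_target hX (X.source a) e
    have h₅ := dist_target hX (X.target a) e
    have h₆ := dist_target hX (X.target b) e
    rw [SimpleGraph.dist_comm, SimpleGraph.dist_comm (v := X.source e)] at h₄ h₅ h₆
    rw [hba] at h₃
    obtain ⟨a', b', hsq, ha'⟩ := (exists_dist_eq hX (X.target e)).2.2 a b hba.symm
      (by rintro rfl; omega) (by omega) (by omega)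
    have h₇ := dist_target hX (X.source e) b'
    have h₈ := dist_target hX (X.target e) b'
    rw [hsq.source_right, ← hsq.target_eq] at h₇ h₈
    have hpar : X.Parallel e a' := by
      refine ih a' (by rw [hsq.source_left, hb]) ?_ ?_
      · rw [mem_side, SimpleGraph.dist_comm, SimpleGraph.dist_comm (v := X.target e),
          hsq.source_left]
        omega
      · rw [mem_side, SimpleGraph.dist_comm, SimpleGraph.dist_comm (v := X.target e)]
        omega
    obtain ⟨s, rfl, -, rfl, -⟩ := hsq
    exact hpar.trans _ _ _ (.rel _ _ (.opposite s _ _ 0))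

/-- Two directions at a vertex of a cube span a square. -/
theorem squareAt_of_cube {n : ℕ} (c : X.Cube n) (t : Fin n → Bool) {i j : Fin n} (hij : i ≠ j) :
    X.SquareAt (X.edge c (Function.update t j false) i) (X.edge c (Function.update t i false) j)
      (X.edge c (Function.update t j true) i) (X.edge c (Function.update t i true) j) := by
  refine ⟨X.face ⟨fun x => Function.update (Function.update t i (x 0)) j (x 1), fun x y => ?_⟩ c,
    ?_, ?_, ?_, ?_⟩
  · have hinj : Function.Injective ![i, j] := by
      intro a b
      fin_cases a <;> fin_cases b <;> simp [hij, hij.symm]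
    rw [hammingDist, hammingDist, ← Finset.card_map ⟨_, hinj⟩]
    congr 1
    ext k
    by_cases hi : k = i
    · subst hi
      simp [hij, hij.symm, Fin.exists_fin_two]
    · by_cases hj : k = j
      · subst hj
        simp [hij, Fin.exists_fin_two]
      · simp [hi, hj, Ne.symm hi, Ne.symm hj, Fin.exists_fin_two]
  all_goals
    apply edge_face
    intro b
    simp [Function.update_comm hij]

/-- Parallel edges of a cube have the same sides. -/
theorem side_edge_eq (hX : X.IsCAT0) {n : ℕ} (c : X.Cube n) (t t' : Fin n → Bool) (i : Fin n) :
    X.side (X.edge c t i) = X.side (X.edge c t' i) := by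
  have hstep (t : Fin n → Bool) (j : Fin n) (b : Bool) :
      X.side (X.edge c (Function.update t j b) i) = X.side (X.edge c t i) := by
    by_cases hij : i = j
    · subst hij
      unfold edge
      congr 2
      ext1
      funext x
      exact Function.update_idem _ _ _
    · have h := side_eq_of_squareAt hX (squareAt_of_cube c t hij)
      have h' (b : Bool) : X.side (X.edge c (Function.update t j b) i) =
          X.side (X.edge c (Function.update t j true) i) := by
        cases b
        · exact h
        · rfl
      rw [h' b, ← h' (t j), Function.update_eq_self]
  have hS (S : Finset (Fin n)) :
      X.side (X.edge c (S.piecewise t t') i) = X.side (X.edge c t' i) := by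
    induction S using Finset.induction_on with
    | empty => simp
    | insert j S _ ih => rw [Finset.piecewise_insert, hstep, ih]
  simpa using hS Finset.univ

theorem vertex_mem_side (hX : X.IsCAT0) {n : ℕ} (c : X.Cube n) (s t : Fin n → Bool) (i : Fin n) :
    X.vertex c s ∈ X.side (X.edge c t i) ↔ s i = false := by
  rw [side_edge_eq hX c t s]
  cases h : s i
  · have h₁ := source_mem_side hX (X.edge c s i)
    rw [source_edge, ← h, Function.update_eq_self] at h₁
    simpa using h₁
  · have h₁ := target_notMem_side (X.edge c s i)
    rw [target_edge, ← h, Function.update_eq_self] at h₁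
    simpa using h₁

theorem side_eq_or_eq_compl (hX : X.IsCAT0) {e a : X.Edge} (h : X.Parallel e a) :
    X.side a = X.side e ∨ X.side a = (X.side e)ᶜ := by
  induction h with
  | rel _ _ h =>
    cases h with
    | reverse => exact Or.inr (side_reverse hX _)
    | opposite s t t' i => exact Or.inl (side_edge_eq hX s t' t i)
  | refl => exact Or.inl rfl
  | symm _ _ _ ih =>
    obtain ih | ih := ih
    · exact Or.inl ih.symm
    · exact Or.inr (by rw [ih, compl_compl])
  | trans _ _ _ _ _ ih ih' =>
    obtain ih | ih := ih <;> obtain ih' | ih' := ih' <;> simp [ih, ih']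

theorem cut_reverse (e : X.Edge) : X.cut (X.reverse e) = X.cut e := by
  have h (a : X.Edge) : X.Parallel (X.reverse e) a ↔ X.Parallel e a :=
    ⟨fun h => .trans _ _ _ (.rel _ _ (.reverse e)) h,
      fun h => .trans _ _ _ (.symm _ _ (.rel _ _ (.reverse e))) h⟩
  ext u v
  simp only [cut, h]

theorem mem_side_iff_of_cut_adj (hX : X.IsCAT0) {e : X.Edge} {u v : X.Vertex}
    (h : (X.cut e).Adj u v) : u ∈ X.side e ↔ v ∈ X.side e := by
  have key (a : X.Edge) (ha : ¬ X.Parallel e a) :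
      X.source a ∈ X.side e ↔ X.target a ∈ X.side e := by
    constructor
    · intro hs
      by_contra ht
      exact ha (parallel_of_mem_side hX hs ht)
    · intro ht
      by_contra hs
      refine ha (.trans _ _ _ (parallel_of_mem_side hX (a := X.reverse a) ?_ ?_)
        (.symm _ _ (.rel _ _ (.reverse a))))
      · rwa [source_reverse]
      · rwa [target_reverse]
  obtain ⟨-, a, ha, ⟨rfl, rfl⟩ | ⟨rfl, rfl⟩⟩ := h
  · exact key a ha
  · exact (key a ha).symm

theorem mem_side_iff_of_cut_reachable (hX : X.IsCAT0) {e : X.Edge} {u v : X.Vertex}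
    (h : (X.cut e).Reachable u v) : u ∈ X.side e ↔ v ∈ X.side e := by
  obtain ⟨p⟩ := h
  induction p with
  | nil => rfl
  | cons h _ ih => exact (mem_side_iff_of_cut_adj hX h).trans ih

/-- A geodesic to the initial vertex of `e` stays in the side of `e`. -/
theorem cut_reachable_source (hX : X.IsCAT0) {e : X.Edge} : ∀ {x : X.Vertex}, x ∈ X.side e →
    (X.cut e).Reachable x (X.source e) := by
  suffices ∀ (k : ℕ) (x : X.Vertex), X.skeleton.dist (X.source e) x = k → x ∈ X.side e →
      (X.cut e).Reachable x (X.source e) from fun {x} => this _ x rfl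
  intro k
  induction k with
  | zero =>
    intro x h _
    rw [(skeleton_connected hX).dist_eq_zero_iff.1 h]
  | succ k ih =>
    intro x h hx
    obtain ⟨a, rfl, ha⟩ := exists_edge_toward hX h
    have h₁ := dist_target hX (X.target e) a
    have ht : X.target a ∈ X.side e := by
      rw [mem_side, SimpleGraph.dist_comm, SimpleGraph.dist_comm (v := X.target e)] at hx ⊢
      omega
    have hne : X.source a ≠ X.target a := by
      intro h'
      have := dist_source_target hX a
      rw [← h', SimpleGraph.dist_self] at this
      omega
    have hpar : ¬ X.Parallel e a := by
      intro hp
      have hs := source_mem_side hX a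
      have ht' := target_notMem_side a
      obtain h' | h' := side_eq_or_eq_compl hX hp
      · exact ht' (h' ▸ ht)
      · rw [h'] at hs
        exact hs hx
    have hadj : (X.cut e).Adj (X.source a) (X.target a) := ⟨hne, a, hpar, Or.inl ⟨rfl, rfl⟩⟩
    exact hadj.reachable.trans (ih _ ha ht)

theorem supp_eq_side (hX : X.IsCAT0) {e : X.Edge} {v : X.Vertex} (hv : v ∈ X.side e) :
    ((X.cut e).connectedComponentMk v).supp = X.side e := by
  ext w
  rw [SimpleGraph.ConnectedComponent.mem_supp_iff, SimpleGraph.ConnectedComponent.eq]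
  exact ⟨fun h => (mem_side_iff_of_cut_reachable hX h).2 hv,
    fun h => (cut_reachable_source hX h).trans (cut_reachable_source hX hv).symm⟩

theorem isHalfSpace_side (hX : X.IsCAT0) (e : X.Edge) : X.IsHalfSpace (X.side e) :=
  ⟨e, _, (supp_eq_side hX (source_mem_side hX e)).symm⟩

theorem IsHalfSpace.exists_eq_side (hX : X.IsCAT0) {H : Set X.Vertex} (hH : X.IsHalfSpace H) :
    ∃ e, H = X.side e := by
  obtain ⟨e, K, rfl⟩ := hH
  induction K using SimpleGraph.ConnectedComponent.ind with
  | h v =>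
    by_cases hv : v ∈ X.side e
    · exact ⟨e, supp_eq_side hX hv⟩
    · refine ⟨X.reverse e, ?_⟩
      rw [← supp_eq_side hX (e := X.reverse e) (v := v) (by rwa [side_reverse hX]), cut_reverse]

/-- A half-space is determined by any edge that leaves it. -/
theorem IsHalfSpace.eq_side (hX : X.IsCAT0) {H : Set X.Vertex} (hH : X.IsHalfSpace H)
    {a : X.Edge} (hs : X.source a ∈ H) (ht : X.target a ∉ H) : H = X.side a := by
  obtain ⟨e, rfl⟩ := hH.exists_eq_side hX
  obtain h | h := side_eq_or_eq_compl hX (parallel_of_mem_side hX hs ht)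
  · exact h.symm
  · have := source_mem_side hX a
    rw [h] at this
    exact absurd hs this

theorem IsHalfSpace.mem_iff (hX : X.IsCAT0) {H : Set X.Vertex} (hH : X.IsHalfSpace H)
    {u v : X.Vertex} (huv : X.skeleton.Adj u v) (hu : u ∈ H) (hv : v ∉ H) (x : X.Vertex) :
    x ∈ H ↔ X.skeleton.dist x u < X.skeleton.dist x v := by
  obtain ⟨a, rfl, rfl⟩ := exists_edge_of_adj huv
  rw [hH.eq_side hX hu hv, mem_side]

/-- At most `d(a, b)` half-spaces contain `b` and not `a`, because every edge of a path enters at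
most one half-space. -/
theorem encard_separating_le (hX : X.IsCAT0) (a b : X.Vertex) :
    {H | X.IsHalfSpace H ∧ a ∉ H ∧ b ∈ H}.encard ≤ X.skeleton.dist a b := by
  obtain ⟨p, hp⟩ := (skeleton_connected hX).exists_walk_length_eq_dist a b
  rw [← hp]
  clear hp
  induction p with
  | nil =>
    rw [Set.encard_eq_zero.2]
    · exact zero_le
    · exact Set.eq_empty_of_forall_notMem fun H hH => hH.2.1 hH.2.2
  | @cons a b c hab p ih =>
    calc {H | X.IsHalfSpace H ∧ a ∉ H ∧ c ∈ H}.encard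
        ≤ ({H | X.IsHalfSpace H ∧ a ∉ H ∧ b ∈ H} ∪
            {H | X.IsHalfSpace H ∧ b ∉ H ∧ c ∈ H}).encard := by
          refine Set.encard_le_encard fun H hH => ?_
          by_cases hb : b ∈ H
          · exact Or.inl ⟨hH.1, hH.2.1, hb⟩
          · exact Or.inr ⟨hH.1, hb, hH.2.2⟩
      _ ≤ 1 + p.length := by
          refine (Set.encard_union_le _ _).trans (add_le_add ?_ ih)
          refine Set.encard_le_one_iff.2 fun H K hH hK => ?_
          ext x
          rw [hH.1.mem_iff hX hab.symm hH.2.2 hH.2.1, hK.1.mem_iff hX hab.symm hK.2.2 hK.2.1]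
      _ = ((SimpleGraph.Walk.cons hab p).length : ℕ∞) := by
          rw [SimpleGraph.Walk.length_cons, Nat.cast_add, Nat.cast_one, add_comm]

namespace Automorphism

variable (g : X.Automorphism)

/-! ### Automorphisms and their axes -/

theorem onVertex_source (e : X.Edge) : g.onVertex (X.source e) = X.source (g.toEquiv 1 e) :=
  g.map_face _ e

theorem onVertex_target (e : X.Edge) : g.onVertex (X.target e) = X.target (g.toEquiv 1 e) :=
  g.map_face _ e

theorem adj_iff (u v : X.Vertex) :
    X.skeleton.Adj (g.onVertex u) (g.onVertex v) ↔ X.skeleton.Adj u v := by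
  constructor
  · intro h
    refine ⟨fun huv => h.1 (congrArg _ huv), ?_⟩
    obtain ⟨e, hs, ht⟩ := exists_edge_of_adj h
    obtain ⟨e, rfl⟩ := (g.toEquiv 1).surjective e
    rw [← onVertex_source] at hs
    rw [← onVertex_target] at ht
    exact ⟨e, Or.inl ⟨g.onVertex.injective hs, g.onVertex.injective ht⟩⟩
  · intro h
    refine ⟨fun huv => h.1 (g.onVertex.injective huv), ?_⟩
    obtain ⟨e, rfl, rfl⟩ := exists_edge_of_adj h
    exact ⟨g.toEquiv 1 e, Or.inl ⟨(g.onVertex_source e).symm, (g.onVertex_target e).symm⟩⟩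

theorem dist_onVertex (hX : X.IsCAT0) (u v : X.Vertex) :
    X.skeleton.dist (g.onVertex u) (g.onVertex v) = X.skeleton.dist u v := by
  let φ : X.skeleton ≃g X.skeleton := ⟨g.onVertex, fun {a b} => g.adj_iff a b⟩
  apply le_antisymm
  · obtain ⟨p, hp⟩ := (skeleton_connected hX).exists_walk_length_eq_dist u v
    rw [← hp, ← SimpleGraph.Walk.length_map φ.toHom p]
    exact SimpleGraph.dist_le _
  · obtain ⟨p, hp⟩ :=
      (skeleton_connected hX).exists_walk_length_eq_dist (g.onVertex u) (g.onVertex v)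
    have h := SimpleGraph.dist_le (p.map φ.symm.toHom)
    rw [SimpleGraph.Walk.length_map, hp] at h
    have hφ (w : X.Vertex) : φ.symm.toHom (g.onVertex w) = w := g.onVertex.symm_apply_apply w
    rwa [hφ, hφ] at h

theorem dist_iterate (hX : X.IsCAT0) (k : ℕ) (u v : X.Vertex) :
    X.skeleton.dist (g.onVertex^[k] u) (g.onVertex^[k] v) = X.skeleton.dist u v := by
  induction k with
  | zero => rfl
  | succ k ih => rw [Function.iterate_succ_apply', Function.iterate_succ_apply',
      g.dist_onVertex hX, ih]

theorem dist_iterate_mul_le (hX : X.IsCAT0) (x : X.Vertex) (k m : ℕ) :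
    X.skeleton.dist x (g.onVertex^[k * m] x) ≤ m * X.skeleton.dist x (g.onVertex^[k] x) := by
  induction m with
  | zero => simp
  | succ m ih =>
    have h := (skeleton_connected hX).dist_triangle (u := x) (v := g.onVertex^[k * m] x)
      (w := g.onVertex^[k * (m + 1)] x)
    rw [mul_add_one, Function.iterate_add_apply, g.dist_iterate hX] at h
    rw [mul_add_one, Function.iterate_add_apply, add_one_mul]
    omega

theorem isHalfSpace_preimage (hX : X.IsCAT0) {H : Set X.Vertex} (hH : X.IsHalfSpace H) (k : ℕ) :
    X.IsHalfSpace (g.onVertex^[k] ⁻¹' H) := by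
  induction k with
  | zero => exact hH
  | succ k ih =>
    obtain ⟨e, he⟩ := ih.exists_eq_side hX
    obtain ⟨e, rfl⟩ := (g.toEquiv 1).surjective e
    convert isHalfSpace_side hX e using 1
    rw [Function.iterate_succ, Set.preimage_comp, he]
    ext x
    rw [Set.mem_preimage, mem_side, mem_side, ← onVertex_source, ← onVertex_target,
      g.dist_onVertex hX, g.dist_onVertex hX]

variable {g}

theorem IsAxis.iterate {γ : ℤ → X.Vertex} (hγ : g.IsAxis γ) (i : ℤ) (k : ℕ) :
    g.onVertex^[k] (γ i) = γ (i + k * g.translationLength) := by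
  induction k with
  | zero => simp
  | succ k ih =>
    rw [Function.iterate_succ_apply', ih, hγ.2]
    congr 1
    push_cast
    ring

/-- An axis crosses a half-space at most once. -/
theorem IsAxis.mem_iff (hX : X.IsCAT0) {γ : ℤ → X.Vertex} (hγ : g.IsAxis γ) {H : Set X.Vertex}
    (hH : X.IsHalfSpace H) {i : ℤ} (hi : γ i ∉ H) (hi' : γ (i + 1) ∈ H) (j : ℤ) :
    γ j ∈ H ↔ i < j := by
  have hadj : X.skeleton.Adj (γ (i + 1)) (γ i) := by
    have h := hγ.1 (i + 1) i
    rw [add_sub_cancel_left, abs_one] at h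
    exact SimpleGraph.dist_eq_one_iff_adj.1 (by exact_mod_cast h)
  rw [hH.mem_iff hX hadj hi' hi]
  have h₁ := hγ.1 j (i + 1)
  have h₂ := hγ.1 j i
  rcases abs_cases (j - (i + 1)) with h₃ | h₃ <;> rcases abs_cases (j - i) with h₄ | h₄ <;> omega

/-- If `g` has an axis, then the orbit of each vertex `x` that realizes the translation length
lies on a geodesic: otherwise it would progress more slowly than the axis, from which it stays at
bounded distance. -/
theorem IsAxis.dist_iterate (hX : X.IsCAT0) {γ : ℤ → X.Vertex} (hγ : g.IsAxis γ) {x : X.Vertex}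
    (hx : X.skeleton.dist x (g.onVertex x) = g.translationLength) (k : ℕ) :
    X.skeleton.dist x (g.onVertex^[k] x) = k * g.translationLength := by
  apply le_antisymm
  · have h := g.dist_iterate_mul_le hX x 1 k
    rwa [one_mul, Function.iterate_one, hx] at h
  by_contra! hlt
  set D := X.skeleton.dist x (γ 0) with hD
  set m := 2 * D + 1 with hm
  have h₁ := g.dist_iterate_mul_le hX x k m
  have h₂ : X.skeleton.dist (γ 0) (g.onVertex^[k * m] (γ 0)) = k * m * g.translationLength := by
    have h := hγ.1 0 (0 + (k * m : ℕ) * g.translationLength)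
    rw [← hγ.iterate, zero_add, zero_sub, abs_neg, abs_of_nonneg (by positivity)] at h
    exact_mod_cast h
  have h₃ := (skeleton_connected hX).dist_triangle (u := γ 0) (v := x)
    (w := g.onVertex^[k * m] (γ 0))
  have h₄ := (skeleton_connected hX).dist_triangle (u := x) (v := g.onVertex^[k * m] x)
    (w := g.onVertex^[k * m] (γ 0))
  rw [Automorphism.dist_iterate g hX, ← hD] at h₄
  rw [SimpleGraph.dist_comm (u := γ 0) (v := x), ← hD] at h₃
  have h₅ : m * (X.skeleton.dist x (g.onVertex^[k] x) + 1) ≤ m * (k * g.translationLength) :=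
    Nat.mul_le_mul_left _ hlt
  have h₆ : k * m * g.translationLength = m * (k * g.translationLength) := by ring
  rw [mul_add_one] at h₅
  omega

/-- On a path that leaves `H`, there is an edge that leaves `H`. -/
theorem _root_.SimpleGraph.Walk.exists_adj_mem_notMem {V : Type*} {G : SimpleGraph V}
    (hG : G.Connected) {H : Set V} {a b : V} (p : G.Walk a b) (ha : a ∈ H) (hb : b ∉ H) :
    ∃ u v, G.Adj u v ∧ u ∈ H ∧ v ∉ H ∧ G.dist a u + 1 + G.dist v b ≤ p.length := by
  induction p with
  | nil => exact absurd ha hb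
  | @cons a c b hac p ih =>
    by_cases hc : c ∈ H
    · obtain ⟨u, v, huv, hu, hv, h⟩ := ih hc hb
      refine ⟨u, v, huv, hu, hv, ?_⟩
      have h₁ := hG.dist_triangle (u := a) (v := c) (w := u)
      rw [SimpleGraph.dist_eq_one_iff_adj.2 hac] at h₁
      rw [SimpleGraph.Walk.length_cons]
      omega
    · refine ⟨a, c, hac, ha, hc, ?_⟩
      have := SimpleGraph.dist_le p
      rw [SimpleGraph.dist_self, SimpleGraph.Walk.length_cons]
      omega

/-- The orbit of a vertex that realizes the translation length does not leave a half-space in the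
positive half-space axis.  If it did, it would never return, while the axis ends in this half-space;
then infinitely many translates of the half-space would separate a point of the axis from the
vertex. -/
theorem onVertex_mem_of_mem (hX : X.IsCAT0) (hg : g.IsHyperbolic) {H : Set X.Vertex}
    (hH : H ∈ g.positiveHalfSpaces) {x : X.Vertex}
    (hx : X.skeleton.dist x (g.onVertex x) = g.translationLength) (hxH : x ∈ H) :
    g.onVertex x ∈ H := by
  by_contra hgx
  obtain ⟨hH, γ, hγ, i, hi, hi'⟩ := hH
  have hℓ := hg.2
  have hmem := hγ.mem_iff hX hH hi hi'
  have hout (k : ℕ) : g.onVertex^[k + 1] x ∉ H := by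
    obtain ⟨p, hp⟩ := (skeleton_connected hX).exists_walk_length_eq_dist x (g.onVertex x)
    obtain ⟨u, v, huv, hu, hv, h⟩ := p.exists_adj_mem_notMem (skeleton_connected hX) hxH hgx
    rw [hp, hx] at h
    rw [hH.mem_iff hX huv hu hv, SimpleGraph.dist_comm, SimpleGraph.dist_comm (v := v)]
    have h₁ := (skeleton_connected hX).dist_triangle (u := v) (v := g.onVertex x)
      (w := g.onVertex^[k + 1] x)
    have h₂ := (skeleton_connected hX).dist_triangle (u := x) (v := u)
      (w := g.onVertex^[k + 1] x)
    rw [hγ.dist_iterate hX hx, add_one_mul] at h₂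
    have h₃ : X.skeleton.dist (g.onVertex x) (g.onVertex^[k + 1] x) =
        k * g.translationLength :=
      hγ.dist_iterate hX (by rw [g.dist_onVertex hX, hx]) k
    omega
  -- `γ (i + 1 - k ℓ)` lies in the `k`-th translate and in no earlier one.
  have hinj : Function.Injective fun k : ℕ => g.onVertex^[k] ⁻¹' H := by
    refine Function.Injective.of_lt_imp_ne fun k m hkm h => ?_
    have h' := Set.ext_iff.1 h (γ (i + 1 - m * g.translationLength))
    simp only [Set.mem_preimage, hγ.iterate, hmem] at h'
    have h₁ : ((k : ℤ) + 1) * g.translationLength ≤ m * g.translationLength := by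
      gcongr
      exact_mod_cast hkm
    rw [add_one_mul] at h₁
    omega
  have hfin : {K | X.IsHalfSpace K ∧ x ∉ K ∧ γ 0 ∈ K}.Finite :=
    Set.finite_of_encard_le_coe (encard_separating_le hX x (γ 0))
  refine (Set.infinite_range_of_injective (hinj.comp (add_left_injective (i.natAbs + 1)))) ?_
  refine hfin.subset ?_
  rintro _ ⟨k, rfl⟩
  refine ⟨g.isHalfSpace_preimage hX hH _, hout _, ?_⟩
  change g.onVertex^[k + (i.natAbs + 1)] (γ 0) ∈ H
  rw [hγ.iterate, hmem]
  have h₁ : ((k + (i.natAbs + 1) : ℕ) : ℤ) * 1 ≤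
      ((k + (i.natAbs + 1) : ℕ) : ℤ) * g.translationLength := by
    gcongr
    exact_mod_cast hℓ
  omega

/-- If an edge between vertices that realize the translation length enters a half-space `H` in the
positive half-space axis, then `H` separates the initial vertex from its image: otherwise the image
of the edge would enter `H` as well, so that `g` would preserve `H`. -/
theorem onVertex_mem_of_adj (hX : X.IsCAT0) (hg : g.IsHyperbolic) {H : Set X.Vertex}
    (hH : H ∈ g.positiveHalfSpaces) {x y : X.Vertex} (hxy : X.skeleton.Adj x y)
    (hy : X.skeleton.dist y (g.onVertex y) = g.translationLength) (hxH : x ∉ H) (hyH : y ∈ H) :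
    g.onVertex x ∈ H := by
  by_contra hgx
  have hgy := onVertex_mem_of_mem hX hg hH hy hyH
  obtain ⟨hH, γ, hγ, i, hi, hi'⟩ := hH
  have h (z : X.Vertex) : g.onVertex z ∈ H ↔ z ∈ H := by
    rw [hH.mem_iff hX ((g.adj_iff y x).2 hxy.symm) hgy hgx, g.dist_onVertex hX,
      g.dist_onVertex hX, ← hH.mem_iff hX hxy.symm hyH hxH]
  have hℓ := hg.2
  have hi₁ := hi
  rw [← h, hγ.2, hγ.mem_iff hX hH hi hi'] at hi₁
  omega

/-! ### Cubes of the essential minimal set -/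

/-- Each direction of a cube that `proj` does not collapse is dual to a half-space in the positive
half-space axis. -/
theorem exists_positiveHalfSpace (hX : X.IsCAT0) {n : ℕ} (b : X.Cube n) (i : Fin n)
    (h : ∃ t, g.proj (X.vertex b (Function.update t i false)) ≠
      g.proj (X.vertex b (Function.update t i true))) :
    ∃ H ∈ g.positiveHalfSpaces, ∃ ε : Bool, ∀ s, X.vertex b s ∈ H ↔ s i = ε := by
  obtain ⟨t, ht⟩ := h
  rw [← source_edge, ← target_edge] at ht
  set e := X.edge b t i with he
  obtain ⟨H, hH, hne⟩ : ∃ H ∈ g.positiveHalfSpaces, ¬ (X.source e ∈ H ↔ X.target e ∈ H) := by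
    by_contra! hcon
    refine ht (Subtype.ext (Set.ext fun K => and_congr_right fun hK => ?_))
    obtain hK | hK := hK
    · exact hcon K hK
    · exact not_iff_not.1 (hcon _ hK)
  refine ⟨H, hH, ?_⟩
  by_cases hs : X.source e ∈ H
  · refine ⟨false, fun s => ?_⟩
    rw [hH.1.eq_side hX hs (fun ht => hne (iff_of_true hs ht)), he, vertex_mem_side hX]
  · refine ⟨true, fun s => ?_⟩
    have ht : X.target e ∈ H := by
      by_contra ht
      exact hne (iff_of_false hs ht)
    rw [hH.1.eq_side hX (a := X.reverse e) (by rwa [source_reverse]) (by rwa [target_reverse]),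
      side_reverse hX, Set.mem_compl_iff, he, vertex_mem_side hX, Bool.not_eq_false]

/-- A cube of the minimal set that `proj` embeds has dimension at most the translation length: at a
suitable corner `x`, the half-spaces dual to its edges all separate `x` from its image. -/
theorem le_translationLength (hX : X.IsCAT0) (hg : g.IsHyperbolic) {n : ℕ} {b : X.Cube n}
    (hb : b ∈ g.minimalSet.cubes n)
    (hinj : Function.Injective fun t => g.proj (X.vertex b t)) :
    n ≤ g.translationLength := by
  have hex (i : Fin n) : ∃ H ∈ g.positiveHalfSpaces, ∃ ε : Bool,
      ∀ s, X.vertex b s ∈ H ↔ s i = ε := by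
    refine exists_positiveHalfSpace hX b i ⟨fun _ => false, fun h => ?_⟩
    simpa using congrFun (hinj h) i
  choose H hH ε hε using hex
  -- The corner that lies in none of the half-spaces, and its neighbours in the cube.
  set t : Fin n → Bool := fun i => !ε i with ht
  have hx (i : Fin n) : X.vertex b t ∉ H i := by
    simp [hε, ht]
  have hy (i : Fin n) : X.vertex b (Function.update t i (ε i)) ∈ H i := by
    simp [hε]
  have hadj (i : Fin n) :
      X.skeleton.Adj (X.vertex b t) (X.vertex b (Function.update t i (ε i))) := by
    refine ⟨fun h => hx i (h ▸ hy i), X.edge b t i, ?_⟩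
    rw [source_edge, target_edge]
    have hti : Function.update t i (!ε i) = t := Function.update_eq_self i t
    cases hi : ε i <;> rw [hi] at hti
    · exact Or.inr ⟨rfl, congrArg _ hti⟩
    · exact Or.inl ⟨congrArg _ hti, rfl⟩
  have hHinj : Function.Injective H := by
    intro i j hij
    by_contra hne
    have h := hy i
    rw [hij, hε, Function.update_of_ne (Ne.symm hne)] at h
    simp [ht] at h
  have hsub : Set.range H ⊆ {K | X.IsHalfSpace K ∧ X.vertex b t ∉ K ∧
      g.onVertex (X.vertex b t) ∈ K} := by
    rintro _ ⟨i, rfl⟩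
    exact ⟨(hH i).1, hx i, onVertex_mem_of_adj hX hg (hH i) (hadj i) (hb _) (hx i) (hy i)⟩
  have hcard := (Set.encard_le_encard hsub).trans (encard_separating_le hX _ _)
  rw [← Set.image_univ, hHinj.encard_image, Set.encard_univ, ENat.card_eq_coe_fintype_card,
    Fintype.card_fin, hb t] at hcard
  exact_mod_cast hcard

end Automorphism

end CubeComplex

theorem mainTheorem8 (X : CubeComplex) (hX : X.IsCAT0) (g : X.Automorphism)
    (hg : g.IsHyperbolic) :
    g.essentialMinimalSet.dim < ⊤ ∧
      g.essentialMinimalSet.dim ≤ (g.translationLength : ℕ∞) := by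
  have h : g.essentialMinimalSet.dim ≤ (g.translationLength : ℕ∞) := by
    refine iSup₂_le fun n hn => ?_
    obtain ⟨c, b, hb, hc⟩ := hn
    have hinj : Function.Injective fun t => g.proj (X.vertex b t) := by
      have : (fun t => g.proj (X.vertex b t)) = c.1 := funext fun t => (hc t).symm
      rw [this]
      exact c.2.1
    exact_mod_cast CubeComplex.Automorphism.le_translationLength hX hg hb hinj
  exact ⟨h.trans_lt (ENat.natCast_lt_top _), h⟩
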